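/- Let $0<k<n$ be integers and let $\mathrm{Gr}(k,\mathbb C^n)$ be the set of $k$-dimensional linear subspaces of $\mathbb C^n$. A Schubert condition is a list $\alpha=(\alpha_1<\dots<\alpha_k)$ of elements of $\{1,\dots,n\}$; put $|\alpha|:=k(n-k)-\sum_{i=1}^k(\alpha_i-i)$. For a flag $F_\bullet$ in $\mathbb C^n$ with $\dim F_i=i$, let $X_\alpha F_\bullet:=\{H\in \mathrm{Gr}(k,\mathbb C^n) : \dim(H\cap F_{\alpha_i})\ge i \text{ for } 1\le i\le k\}$. Let $\gamma=(\gamma_1,\dots,\gamma_n)$ be a parametrized rational normal curve, that is, a basis of the space of complex forms of degree $n-1$ in $(s,t)$. For $a\in\mathbb P^1=\mathbb C\cup\{\infty\}$ let $F_\bullet(a)$ be the osculating flag, $F_i(a):=\langle\gamma(a),\gamma'(a),\dots,\gamma^{(i-1)}(a)\rangle$, where the derivatives are those of $t\mapsto\gamma(1,t)$ at $t=a$ if $a\in\mathbb C$, and those of $s\mapsto\gamma(s,1)$ at $s=0$ if $a=\infty$; put $X_\alpha(a):=X_\alpha F_\bullet(a)$. Then for every $H\in \mathrm{Gr}(k,\mathbb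 C^n)$ there are Schubert conditions $\alpha^1,\dots,\alpha^m$ with all $|\alpha^i|>0$ and $|\alpha^1|+\dots+|\alpha^m|=k(n-k)$ (a Schubert problem), and pairwise distinct points $a_1,\dots,a_m\in\mathbb P^1$, such that $$H\in X_{\alpha^1}(a_1)\cap\dots\cap X_{\alpha^m}(a_m),$$ and these data are unique up to simultaneous reordering: if $\beta^1,\dots,\beta^p$ are Schubert conditions with all $|\beta^i|>0$ and $\sum_i|\beta^i|=k(n-k)$, and $b_1,\dots,b_p\in\mathbb P^1$ are pairwise distinct points with $H\in X_{\beta^1}(b_1)\cap\dots\cap X_{\beta^p}(b_p)$, then there is a bijection $e:\{1,\dots,p\}\to\{1,\dots,m\}$ with $\beta^i=\alpha^{e(i)}$ and $b_i=a_{e(i)}$ for all $i$. -/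

import Mathlib

/-- The Grassmannian of `k`-dimensional linear subspaces of `ℂⁿ`. -/
def Gr (k n : ℕ) : Type :=
  {H : Submodule ℂ (Fin n → ℂ) // Module.finrank ℂ H = k}

/-- Schubert conditions: strictly increasing lists `α` of `k` entries of `[n] = {1, …, n}`.
With indices starting from zero, the `i`-th entry of the list (`1 ≤ i ≤ k`)
is `(α (i - 1) : ℕ) + 1`. -/
abbrev SchubertCondition (k n : ℕ) : Type := Fin k ↪o Fin n

/-- The codimension `|α| = k (n - k) - ∑ i, (α_i - i)` of a Schubert condition,
an integer (both `α_i` and `i` are shifted by one here, so `α_i - i` is unchanged). -/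
def SchubertCondition.codim {k n : ℕ} (α : SchubertCondition k n) : ℤ :=
  (k : ℤ) * ((n : ℤ) - (k : ℤ)) - ∑ i : Fin k, (((α i : ℕ) : ℤ) - ((i : ℕ) : ℤ))

/-- The Schubert variety `X_α F`, where `F i` is the `i`-dimensional subspace of a flag:
the `k`-planes `H` with `dim (H ∩ F_{α_i}) ≥ i` for `i = 1, …, k`. -/
def schubertVariety {k n : ℕ} (α : SchubertCondition k n)
    (F : ℕ → Submodule ℂ (Fin n → ℂ)) : Set (Gr k n) :=
  {H | ∀ i : Fin k, (i : ℕ) + 1 ≤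
    Module.finrank ℂ (H.1 ⊓ F ((α i : ℕ) + 1) : Submodule ℂ (Fin n → ℂ))}

/-- A list of Schubert conditions is a Schubert problem if the codimensions add up
to `k (n - k)`, the dimension of the Grassmannian. -/
def IsSchubertProblem {k n m : ℕ} (α : Fin m → SchubertCondition k n) : Prop :=
  ∑ i, (α i).codim = (k : ℤ) * ((n : ℤ) - (k : ℤ))

/-- A parametrized rational normal curve in `ℙⁿ⁻¹`: a list `γ₁(s,t), …, γₙ(s,t)` that is a
basis of the space of forms of degree `n - 1` on `ℙ¹`. The variables `X 0`, `X 1` are `s`, `t`. -/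
abbrev RationalNormalCurve (n : ℕ) : Type :=
  Module.Basis (Fin n) ℂ (MvPolynomial.homogeneousSubmodule (Fin 2) ℂ (n - 1))

namespace RationalNormalCurve

open Polynomial

/-- The `j`-th derivative of the curve at a point of `ℙ¹ = ℂ ∪ {∞}`. The point `t ∈ ℂ` is
`(s,t) = (1,t)`, and there the derivatives of `t ↦ γ(1,t)` are taken; the point `∞` is
`(s,t) = (0,1)`, and there the derivatives at `s = 0` of `s ↦ γ(s,1)` are taken. -/
noncomputable def derivAt {n : ℕ} (γ : RationalNormalCurve n) (j : ℕ) :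
    OnePoint ℂ → (Fin n → ℂ)
  | some t => fun i =>
      (derivative^[j] (MvPolynomial.aeval ![(1 : ℂ[X]), X] (γ i).1)).eval t
  | none => fun i =>
      (derivative^[j] (MvPolynomial.aeval ![X, (1 : ℂ[X])] (γ i).1)).eval 0

/-- The osculating flag at `a`: its `i`-th subspace is spanned by
`γ(a), γ'(a), …, γ^{(i-1)}(a)`. -/
noncomputable def osculatingFlag {n : ℕ} (γ : RationalNormalCurve n) (a : OnePoint ℂ) (i : ℕ) :
    Submodule ℂ (Fin n → ℂ) :=
  Submodule.span ℂ ((fun j => γ.derivAt j a) '' Set.Iio i)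

/-- The osculating instance `X_{α¹}(a₁) ∩ ⋯ ∩ X_{αᵐ}(aₘ)`. -/
def osculatingInstance {k n m : ℕ} (γ : RationalNormalCurve n)
    (α : Fin m → SchubertCondition k n) (a : Fin m → OnePoint ℂ) : Set (Gr k n) :=
  ⋂ i, schubertVariety (α i) (γ.osculatingFlag (a i))

end RationalNormalCurve

/-! Composing the curve with the functionals that vanish on `H` gives an (n-k)-dimensional space of
binary forms of degree n-1. Its Wronskian is, up to a scalar, a nonzero form of degree k(n-k), the
data attached to `H` being its zeros.

At a point `a`, let `J` be the set of indices where dim(H ∩ F_i(a)) jumps. Listed in order, `J` is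
the smallest Schubert condition that `H` satisfies at `a` (`position`), and the orders of vanishing
at `a` of the forms are the elements of the complement of `J`. Hence the Wronskian vanishes at `a`
to order |`position`| (`exists_codim_position_eq`). Counting zeros on ℙ¹ shows that these
codimensions sum to k(n-k), which gives existence.

For uniqueness, any condition β satisfied by `H` at `b` dominates the position at `b` entrywise, so
|β| is at most the codimension of the position. Both totals equal k(n-k), so every inequality is an
equality and no zero is missed. -/

/-! ### Wronskians of polynomials: orders of vanishing and degrees. -/

namespace Polynomial

/-- The Wronskian of a family of polynomials. -/
noncomputable def wronskianDet {K : Type*} [Field K] {m : ℕ} (f : Fin m → K[X]) : K[X] :=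
  (Matrix.of fun i j : Fin m => derivative^[(i : ℕ)] (f j)).det

section

variable {K : Type*} [Field K]

/-- Falling factorials are monic of degree i, so the determinant is a Vandermonde determinant; in
characteristic zero its nodes stay distinct. -/
theorem det_descPochhammer_ne_zero [CharZero K] {m : ℕ} {b : Fin m → ℕ}
    (hb : Function.Injective b) :
    (Matrix.of fun i j : Fin m => (descPochhammer K i).eval (b j : K)).det ≠ 0 := by
  have h := Matrix.det_eval_matrixOfPolynomials_eq_det_vandermonde (fun j => (b j : K))
    (fun i : Fin m => descPochhammer K i) (fun i => descPochhammer_natDegree _ _)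
    (fun i => monic_descPochhammer K _)
  rw [← Matrix.det_transpose]
  have h2 : (Matrix.of fun i j : Fin m => (descPochhammer K i).eval (b j : K)).transpose =
    Matrix.of fun i j : Fin m => (descPochhammer K j).eval (b i : K) := rfl
  rw [h2, ← h]
  exact Matrix.det_vandermonde_ne_zero_iff.2 fun i j hij => hb (Nat.cast_injective hij)

/-- Constants commute with differentiation. The Wronskian thus depends, up to a scalar, only on the
spanned space. -/
theorem wronskianDet_sum_smul {m : ℕ} (e : Fin m → K[X]) (A : Matrix (Fin m) (Fin m) K) :
    wronskianDet (fun j => ∑ l, A l j • e l) = wronskianDet e * C A.det := by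
  have hA : C A.det = (A.map (C : K → K[X])).det := by
    rw [← RingHom.mapMatrix_apply, ← RingHom.map_det]
  rw [wronskianDet, wronskianDet, hA, ← Matrix.det_mul]
  congr 1
  ext1 i j
  simp only [Matrix.of_apply, Matrix.mul_apply, Matrix.map_apply, iterate_derivative_sum,
    smul_eq_C_mul, iterate_derivative_C_mul]
  exact Finset.sum_congr rfl fun l _ => mul_comm _ _

theorem prod_pow_mul_wronskianDet {m : ℕ} (x : K[X]) (f : Fin m → K[X]) :
    x ^ (∑ i : Fin m, (i : ℕ)) * wronskianDet f =
      (Matrix.of fun i j : Fin m => x ^ (i : ℕ) * derivative^[(i : ℕ)] (f j)).det := by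
  rw [← Finset.prod_pow_eq_pow_sum, wronskianDet, ← Matrix.det_mul_column]
  rfl

/-- With x = X - a, the operator x^i D^i multiplies x^b by the falling factorial of b, so it
preserves the order filtration at `a` and acts on leading terms by that scalar. -/
theorem exists_pow_mul_iterate_derivative_eq (a : K) (b : ℕ) (g : K[X]) (i : ℕ) :
    ∃ h : K[X], (X - C a) ^ i * derivative^[i] ((X - C a) ^ b * g) = (X - C a) ^ b * h ∧
      h.eval a = (descPochhammer K i).eval (b : K) * g.eval a := by
  have hD (r : ℕ) : (X - C a) * derivative ((X - C a) ^ r) = (r : K[X]) * (X - C a) ^ r := by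
    cases r with
    | zero => simp
    | succ r => simp [derivative_pow]; ring
  induction i with
  | zero => exact ⟨g, by simp⟩
  | succ i ih =>
    obtain ⟨h, h1, h2⟩ := ih
    refine ⟨(b : K[X]) * h + (X - C a) * derivative h - (i : K[X]) * h, ?_, ?_⟩
    · have h3 := congrArg (fun p => (X - C a) * derivative p) h1
      simp only [derivative_mul (f := (X - C a) ^ i), derivative_mul (f := (X - C a) ^ b) (g := h)] at h3
      rw [mul_add, mul_add, ← mul_assoc, ← mul_assoc (X - C a) (derivative _), hD, hD] at h3
      rw [Function.iterate_succ_apply', pow_succ]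
      linear_combination h3 - (i : K[X]) * h1
    · rw [descPochhammer_succ_eval]
      simp [h2]
      ring

/-- Scaling row i by (X - a)^i lets (X - a)^(b j) be pulled out of column j. At `a`, the remaining
determinant is a nonzero multiple of the falling-factorial one. -/
theorem wronskianDet_rootMultiplicity [CharZero K] {m : ℕ} (a : K) (f : Fin m → K[X])
    (hf : ∀ j, f j ≠ 0) (hb : Function.Injective fun j => (f j).rootMultiplicity a) :
    wronskianDet f ≠ 0 ∧
      (wronskianDet f).rootMultiplicity a + ∑ i : Fin m, (i : ℕ) =
        ∑ j, (f j).rootMultiplicity a := by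
  set b := fun j => (f j).rootMultiplicity a with hb'
  choose g hfg hg' using fun j => exists_eq_pow_rootMultiplicity_mul_and_not_dvd (f j) (hf j) a
  have hg (j) : (g j).eval a ≠ 0 := fun h0 => hg' j (dvd_iff_isRoot.2 h0)
  change _ ∧ _ = ∑ j, b j
  replace hfg (j) : (X - C a) ^ b j * g j = f j := (hfg j).symm
  choose h h1 h2 using fun i j : Fin m => exists_pow_mul_iterate_derivative_eq a (b j) (g j) i
  have key := prod_pow_mul_wronskianDet (X - C a) f
  simp only [hfg] at h1
  simp only [h1] at key
  have h3 : (Matrix.of fun i j : Fin m => (X - C a) ^ b j * h i j).det =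
      (X - C a) ^ (∑ j, b j) * (Matrix.of h).det := by
    rw [← Finset.prod_pow_eq_pow_sum, ← Matrix.det_mul_row]
    rfl
  have h4 : ((Matrix.of h).det).eval a ≠ 0 := by
    rw [← coe_evalRingHom, RingHom.map_det]
    have : (evalRingHom a).mapMatrix (Matrix.of h) = Matrix.of fun i j =>
        (g j).eval a * (Matrix.of fun i j : Fin m => (descPochhammer K i).eval (b j : K)) i j := by
      ext1 i j
      simp [h2, mul_comm]
    rw [this, Matrix.det_mul_row]
    exact mul_ne_zero (Finset.prod_ne_zero_iff.2 fun j _ => hg j) (det_descPochhammer_ne_zero hb)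
  have h5 : (Matrix.of h).det ≠ 0 := fun h0 => h4 (by simp [h0])
  have hX (r : ℕ) : (X - C a) ^ r ≠ 0 := pow_ne_zero _ (X_sub_C_ne_zero a)
  rw [h3] at key
  have hW : wronskianDet f ≠ 0 := fun h0 => by
    rw [h0, mul_zero] at key
    exact mul_ne_zero (hX _) h5 key.symm
  refine ⟨hW, ?_⟩
  have := congrArg (rootMultiplicity a) key
  rw [rootMultiplicity_mul (mul_ne_zero (hX _) hW), rootMultiplicity_mul (mul_ne_zero (hX _) h5),
    rootMultiplicity_X_sub_C_pow, rootMultiplicity_X_sub_C_pow, rootMultiplicity_eq_zero h4] at this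
  omega

theorem natDegree_X_pow_mul_iterate_derivative_le (f : K[X]) (i : ℕ) :
    (X ^ i * derivative^[i] f).natDegree ≤ f.natDegree := by
  by_cases h : derivative^[i] f = 0
  · simp [h]
  rw [natDegree_X_pow_mul _ h]
  have h1 := natDegree_iterate_derivative f i
  have h2 : i ≤ f.natDegree := by
    by_contra! h2
    exact h (iterate_derivative_eq_zero h2)
  omega

theorem coeff_X_pow_mul_iterate_derivative (f : K[X]) (i d : ℕ) :
    (X ^ i * derivative^[i] f).coeff d = (descPochhammer K i).eval (d : K) * f.coeff d := by
  rw [coeff_X_pow_mul', descPochhammer_eval_eq_descFactorial]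
  split_ifs with h
  · rw [coeff_iterate_derivative, Nat.sub_add_cancel h, nsmul_eq_mul]
  · simp [Nat.descFactorial_eq_zero_iff_lt.2 (not_le.1 h)]

theorem coeff_prod_sum_of_natDegree_le {ι : Type*} (s : Finset ι) (f : ι → K[X]) (d : ι → ℕ)
    (h : ∀ i ∈ s, (f i).natDegree ≤ d i) :
    (∏ i ∈ s, f i).coeff (∑ i ∈ s, d i) = ∏ i ∈ s, (f i).coeff (d i) := by
  classical
  induction s using Finset.induction_on with
  | empty => simp
  | insert i s hi ih =>
    simp only [Finset.forall_mem_insert] at h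
    rw [Finset.prod_insert hi, Finset.sum_insert hi, Finset.prod_insert hi, ← ih h.2]
    exact coeff_mul_add_eq_of_natDegree_le h.1
      ((natDegree_prod_le _ _).trans (Finset.sum_le_sum h.2))

/-- The counterpart at infinity: X^i D^i does not raise degrees and scales the coefficient of X^d by
a falling factorial of d. -/
theorem wronskianDet_natDegree [CharZero K] {m : ℕ} (f : Fin m → K[X]) (hf : ∀ j, f j ≠ 0)
    (hd : Function.Injective fun j => (f j).natDegree) :
    wronskianDet f ≠ 0 ∧
      (wronskianDet f).natDegree + ∑ i : Fin m, (i : ℕ) = ∑ j, (f j).natDegree := by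
  have key := prod_pow_mul_wronskianDet X f
  set M := (Matrix.of fun i j : Fin m => X ^ (i : ℕ) * derivative^[(i : ℕ)] (f j)) with hM
  have hdeg (i j) : (M i j).natDegree ≤ (f j).natDegree :=
    natDegree_X_pow_mul_iterate_derivative_le _ _
  have h1 : M.det.natDegree ≤ ∑ j, (f j).natDegree := by
    rw [Matrix.det_apply]
    refine natDegree_sum_le_of_forall_le _ _ fun σ _ => (natDegree_smul_le _ _).trans ?_
    exact (natDegree_prod_le _ _).trans (Finset.sum_le_sum fun j _ => hdeg _ j)
  -- Each column has its own degree bound, so the top coefficient of the determinant is the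
  -- determinant of top coefficients.
  have h2 : M.det.coeff (∑ j, (f j).natDegree) =
      (Matrix.of fun i j : Fin m => (M i j).coeff (f j).natDegree).det := by
    rw [Matrix.det_apply, Matrix.det_apply, finsetSum_coeff]
    refine Finset.sum_congr rfl fun σ _ => ?_
    rw [coeff_smul]
    congr 1
    exact coeff_prod_sum_of_natDegree_le _ _ _ fun j _ => hdeg _ j
  have h3 : M.det.coeff (∑ j, (f j).natDegree) ≠ 0 := by
    have : (Matrix.of fun i j : Fin m => (M i j).coeff (f j).natDegree) = Matrix.of fun i j =>
        (f j).leadingCoeff * (Matrix.of fun i j : Fin m =>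
          (descPochhammer K i).eval ((f j).natDegree : K)) i j := by
      ext1 i j
      simp only [hM, Matrix.of_apply]
      rw [coeff_X_pow_mul_iterate_derivative, mul_comm]
      rfl
    rw [h2, this, Matrix.det_mul_row]
    exact mul_ne_zero (Finset.prod_ne_zero_iff.2 fun j _ => leadingCoeff_ne_zero.2 (hf j))
      (det_descPochhammer_ne_zero hd)
  have h4 := h1.antisymm (le_natDegree_of_ne_zero h3)
  have hW : wronskianDet f ≠ 0 := fun h0 => h3 (by rw [← key, h0]; simp)
  exact ⟨hW, by rw [← h4, ← key, natDegree_X_pow_mul _ hW]⟩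

end

end Polynomial

/-! ### Dimension jumps of a subspace along a flag. -/

section SpanFlag

variable {K V : Type*} [Field K] [AddCommGroup V] [Module K V]

/-- The `i`-th subspace of the flag spanned by a sequence of vectors. -/
def spanFlag (v : ℕ → V) (i : ℕ) : Submodule K V :=
  Submodule.span K (v '' Set.Iio i)

open Classical in
/-- The indices at which the dimension of `H ⊓ spanFlag v i` jumps. -/
noncomputable def jumps (n : ℕ) (v : ℕ → V) (H : Submodule K V) : Finset (Fin n) :=
  Finset.univ.filter fun j => v j ∈ H ⊔ spanFlag v j

theorem mem_jumps {n : ℕ} {v : ℕ → V} {H : Submodule K V} {j : Fin n} :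
    j ∈ jumps n v H ↔ v j ∈ H ⊔ spanFlag v j := by
  simp [jumps]

theorem spanFlag_succ (v : ℕ → V) (i : ℕ) :
    (spanFlag v (i + 1) : Submodule K V) = spanFlag v i ⊔ Submodule.span K {v i} := by
  have : Set.Iio (i + 1) = Set.Iio i ∪ {i} := by
    ext; simp
  rw [spanFlag, spanFlag, this, Set.image_union, Submodule.span_union, Set.image_singleton]

theorem finrank_spanFlag {n : ℕ} {v : ℕ → V} (hv : LinearIndependent K fun j : Fin n => v j)
    {i : ℕ} (hi : i ≤ n) : Module.finrank K (spanFlag v i : Submodule K V) = i := by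
  have h := finrank_span_eq_card (hv.comp (Fin.castLE hi) (Fin.castLE_injective hi))
  have hr : Set.range ((fun j : Fin n => v j) ∘ Fin.castLE hi) = v '' Set.Iio i := by
    ext x
    constructor
    · rintro ⟨j, rfl⟩
      exact ⟨j, j.2, rfl⟩
    · rintro ⟨j, hj, rfl⟩
      exact ⟨⟨j, hj⟩, rfl⟩
  rw [hr, Fintype.card_fin] at h
  exact h

theorem finrank_sup_spanFlag [FiniteDimensional K V] {n : ℕ} (v : ℕ → V) (H : Submodule K V)
    {i : ℕ} (hi : i ≤ n) :
    Module.finrank K (H ⊔ spanFlag v i : Submodule K V) +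
      ((jumps n v H).filter fun j : Fin n => (j : ℕ) < i).card = Module.finrank K H + i := by
  induction i with
  | zero =>
    have : Set.Iio (0 : ℕ) = ∅ := Set.eq_empty_of_forall_notMem fun x hx => Nat.not_lt_zero x hx
    rw [spanFlag, this, Set.image_empty, Submodule.span_empty, sup_bot_eq]
    simp
  | succ i ih =>
    have ih := ih (by omega)
    rw [spanFlag_succ, ← sup_assoc]
    by_cases h : v i ∈ H ⊔ spanFlag v i
    · have h1 : ((jumps n v H).filter fun j : Fin n => (j : ℕ) < i + 1) =
          insert ⟨i, hi⟩ ((jumps n v H).filter fun j : Fin n => (j : ℕ) < i) := by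
        ext j
        simp only [Finset.mem_filter, Finset.mem_insert, mem_jumps, Fin.ext_iff]
        constructor
        · intro hj
          by_cases hji : (j : ℕ) = i
          · exact Or.inl hji
          · exact Or.inr ⟨hj.1, by omega⟩
        · rintro (hj | hj)
          · rw [hj]
            exact ⟨h, by omega⟩
          · exact ⟨hj.1, by omega⟩
      rw [h1, Finset.card_insert_of_notMem (by simp), sup_eq_left.2 (by simpa using h)]
      omega
    · have h1 : ((jumps n v H).filter fun j : Fin n => (j : ℕ) < i + 1) =
          ((jumps n v H).filter fun j : Fin n => (j : ℕ) < i) := by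
        refine Finset.filter_congr fun j hj => ?_
        rw [mem_jumps] at hj
        have : (j : ℕ) ≠ i := fun hji => h (hji ▸ hj)
        omega
      rw [h1, Submodule.finrank_sup_span_singleton h]
      omega

theorem finrank_inf_spanFlag [FiniteDimensional K V] {n : ℕ} {v : ℕ → V}
    (hv : LinearIndependent K fun j : Fin n => v j) (H : Submodule K V) {i : ℕ} (hi : i ≤ n) :
    Module.finrank K (H ⊓ spanFlag v i : Submodule K V) =
      ((jumps n v H).filter fun j : Fin n => (j : ℕ) < i).card := by
  have h1 := finrank_sup_spanFlag v H hi
  have h2 := Submodule.finrank_sup_add_finrank_inf_eq H (spanFlag v i)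
  rw [finrank_spanFlag hv hi] at h2
  omega

theorem card_jumps [FiniteDimensional K V] {n : ℕ} {v : ℕ → V}
    (hv : LinearIndependent K fun j : Fin n => v j) (hn : Module.finrank K V = n)
    (H : Submodule K V) : (jumps n v H).card = Module.finrank K H := by
  have h := finrank_inf_spanFlag hv H le_rfl
  have htop : (spanFlag v n : Submodule K V) = ⊤ :=
    Submodule.eq_top_of_finrank_eq (by rw [finrank_spanFlag hv le_rfl, hn])
  rw [htop, inf_top_eq, Finset.filter_true_of_mem fun j _ => j.2] at h
  exact h.symm

/-- For `v` the derivatives of the curve at a point, `f` yields a form vanishing there to order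
exactly `j`. -/
theorem exists_dual_of_notMem_jumps {n : ℕ} {v : ℕ → V} {H : Submodule K V} {j : Fin n}
    (hj : j ∉ jumps n v H) :
    ∃ f : Module.Dual K V, f ∈ H.dualAnnihilator ∧ (∀ l < (j : ℕ), f (v l) = 0) ∧ f (v j) ≠ 0 := by
  rw [mem_jumps] at hj
  obtain ⟨f, hf, hle⟩ := Submodule.exists_le_ker_of_notMem hj
  refine ⟨f, ?_, fun l hl => ?_, hf⟩
  · rw [Submodule.mem_dualAnnihilator]
    exact fun x hx => hle (Submodule.mem_sup_left hx)
  · exact hle (Submodule.mem_sup_right (Submodule.subset_span ⟨l, hl, rfl⟩))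

end SpanFlag

/-! ### Combinatorics of Schubert conditions. -/

section SchubertCombinatorics

/-- Translates the rank inequalities defining a Schubert variety into an entrywise comparison. -/
theorem orderEmbOfFin_le_iff {n k : ℕ} {J : Finset (Fin n)} (h : J.card = k) (i : Fin k)
    (x : Fin n) :
    J.orderEmbOfFin h i ≤ x ↔ (i : ℕ) + 1 ≤ (J.filter fun j : Fin n => (j : ℕ) < (x : ℕ) + 1).card := by
  have hc : (J.filter fun j : Fin n => (j : ℕ) < (x : ℕ) + 1) =
      (Finset.univ.filter fun l => J.orderEmbOfFin h l ≤ x).map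
        (J.orderEmbOfFin h).toEmbedding := by
    conv_lhs => rw [← Finset.map_orderEmbOfFin_univ J h, Finset.filter_map]
    congr 1
    ext l
    simp only [Finset.mem_filter_univ, Function.comp_apply, Fin.le_def]
    exact Nat.lt_succ_iff
  rw [hc, Finset.card_map]
  constructor
  · intro hi
    rw [← Fin.card_Iic]
    refine Finset.card_le_card fun l hl => ?_
    simp only [Finset.mem_filter_univ]
    exact ((J.orderEmbOfFin h).monotone (Finset.mem_Iic.1 hl)).trans hi
  · intro hi
    by_contra hx
    have : (Finset.univ.filter fun l => J.orderEmbOfFin h l ≤ x) ⊆ Finset.Iio i := fun l hl => by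
      simp only [Finset.mem_filter_univ] at hl
      rw [Finset.mem_Iio]
      by_contra hl'
      exact hx (((J.orderEmbOfFin h).monotone (not_lt.1 hl')).trans hl)
    have := Finset.card_le_card this
    rw [Fin.card_Iio] at this
    omega

namespace SchubertCondition

variable {k n : ℕ}

theorem codim_le_codim {α β : SchubertCondition k n} (h : ∀ i, α i ≤ β i) :
    β.codim ≤ α.codim := by
  refine sub_le_sub_left (Finset.sum_le_sum fun i _ => ?_) _
  have : (α i : ℕ) ≤ β i := h i
  omega

theorem eq_of_codim_le {α β : SchubertCondition k n} (h : ∀ i, α i ≤ β i)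
    (hc : α.codim ≤ β.codim) : α = β := by
  have h1 (i) : ((α i : ℕ) : ℤ) - i ≤ ((β i : ℕ) : ℤ) - i := by
    have : (α i : ℕ) ≤ β i := h i
    omega
  have h2 := (Finset.sum_eq_sum_iff_of_le (s := Finset.univ) fun i _ => h1 i).1
    ((Finset.sum_le_sum fun i _ => h1 i).antisymm (by unfold codim at hc; linarith))
  ext i
  have := h2 i (Finset.mem_univ i)
  omega

/-- Passing to the complement puts the codimension in the shape of the Wronskian formula: orders of
vanishing minus 0 + 1 + ⋯ + (n-k-1). -/
theorem codim_orderEmbOfFin {J : Finset (Fin n)} (h : J.card = k) :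
    codim (J.orderEmbOfFin h) =
      ∑ j ∈ Jᶜ, ((j : ℕ) : ℤ) - ∑ i : Fin (n - k), ((i : ℕ) : ℤ) := by
  have hkn : k ≤ n := by simpa [h] using J.card_le_univ
  have gauss (m : ℕ) : 2 * ∑ i : Fin m, ((i : ℕ) : ℤ) = m * (m - 1) := by
    rw [Fin.sum_univ_eq_sum_range (fun i => (i : ℤ))]
    induction m with
    | zero => simp
    | succ m ih => rw [Finset.sum_range_succ, mul_add, ih]; push_cast; ring
  have h1 : ∑ i : Fin k, ((J.orderEmbOfFin h i : ℕ) : ℤ) = ∑ j ∈ J, ((j : ℕ) : ℤ) := by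
    conv_rhs => rw [← Finset.map_orderEmbOfFin_univ J h, Finset.sum_map]
    rfl
  have h2 := Finset.sum_add_sum_compl J fun j : Fin n => ((j : ℕ) : ℤ)
  have g1 := gauss k
  have g2 := gauss n
  have g3 := gauss (n - k)
  rw [Nat.cast_sub hkn] at g3
  rw [codim, Finset.sum_sub_distrib, h1]
  linarith

theorem codim_nonneg (α : SchubertCondition k n) : 0 ≤ α.codim := by
  rcases Nat.eq_zero_or_pos n with rfl | hn
  · rcases Nat.eq_zero_or_pos k with rfl | hk
    · simp [codim]
    · exact (α ⟨0, hk⟩).elim0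
  have key (i : Fin k) : ((α i : ℕ) : ℤ) - i ≤ n - k := by
    -- The k - i entries from the i-th on must fit among the n - α_i values from α_i on.
    have h : (Finset.Ici i).map α.toEmbedding ⊆ Finset.Ici (α i) := fun x hx => by
      obtain ⟨l, hl, rfl⟩ := Finset.mem_map.1 hx
      exact Finset.mem_Ici.2 (α.monotone (Finset.mem_Ici.1 hl))
    have := Finset.card_le_card h
    rw [Finset.card_map, Fin.card_Ici, Fin.card_Ici] at this
    omega
  have := Finset.sum_le_sum fun i (_ : i ∈ Finset.univ) => key i
  rw [Finset.sum_const, Finset.card_univ, Fintype.card_fin, nsmul_eq_mul] at this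
  rw [codim]
  linarith

end SchubertCondition

end SchubertCombinatorics

/-! ### Binary forms and their two dehomogenizations. -/

section BinaryForms

open Polynomial

variable {K : Type*} [Field K]

/-- The exponent of the monomial `s ^ i * t ^ j`. -/
noncomputable def binaryExponent (i j : ℕ) : Fin 2 →₀ ℕ :=
  Finsupp.single 0 i + Finsupp.single 1 j

theorem eq_binaryExponent_iff (m : Fin 2 →₀ ℕ) (i j : ℕ) :
    m = binaryExponent i j ↔ m 0 = i ∧ m 1 = j := by
  simp [binaryExponent, Finsupp.ext_iff, Fin.forall_fin_two]

theorem MvPolynomial.IsHomogeneous.apply_add_apply_of_mem_support {p : MvPolynomial (Fin 2) K}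
    {d : ℕ} (hp : p.IsHomogeneous d) {m : Fin 2 →₀ ℕ} (hm : m ∈ p.support) : m 0 + m 1 = d := by
  have := hp (MvPolynomial.mem_support_iff.1 hm)
  rw [Finsupp.weight_apply, Finsupp.sum_fintype _ _ (by simp)] at this
  simpa using this

theorem MvPolynomial.IsHomogeneous.coeff_aeval_one_X {p : MvPolynomial (Fin 2) K} {d : ℕ}
    (hp : p.IsHomogeneous d) {i j : ℕ} (hij : i + j = d) :
    (MvPolynomial.aeval ![(1 : K[X]), Polynomial.X] p).coeff j = p.coeff (binaryExponent i j) := by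
  rw [MvPolynomial.aeval_def, MvPolynomial.eval₂_eq', finsetSum_coeff]
  rw [Finset.sum_eq_single (binaryExponent i j)]
  · simp [binaryExponent]
  · intro m hm hne
    have h1 := hp.apply_add_apply_of_mem_support hm
    have h2 := (eq_binaryExponent_iff m i j).not.1 hne
    simp
    omega
  · intro hm
    simp [MvPolynomial.notMem_support_iff.1 hm]

theorem MvPolynomial.IsHomogeneous.coeff_aeval_X_one {p : MvPolynomial (Fin 2) K} {d : ℕ}
    (hp : p.IsHomogeneous d) {i j : ℕ} (hij : i + j = d) :
    (MvPolynomial.aeval ![Polynomial.X, (1 : K[X])] p).coeff i = p.coeff (binaryExponent i j) := by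
  rw [MvPolynomial.aeval_def, MvPolynomial.eval₂_eq', finsetSum_coeff]
  rw [Finset.sum_eq_single (binaryExponent i j)]
  · simp [binaryExponent]
  · intro m hm hne
    have h1 := hp.apply_add_apply_of_mem_support hm
    have h2 := (eq_binaryExponent_iff m i j).not.1 hne
    simp
    omega
  · intro hm
    simp [MvPolynomial.notMem_support_iff.1 hm]

theorem MvPolynomial.IsHomogeneous.natDegree_aeval_one_X_le {p : MvPolynomial (Fin 2) K} {d : ℕ}
    (hp : p.IsHomogeneous d) : (MvPolynomial.aeval ![(1 : K[X]), Polynomial.X] p).natDegree ≤ d := by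
  rw [MvPolynomial.aeval_def, MvPolynomial.eval₂_eq']
  refine natDegree_sum_le_of_forall_le _ _ fun m hm => ?_
  have := hp.apply_add_apply_of_mem_support hm
  simp only [Fin.prod_univ_two, Matrix.cons_val_zero, Matrix.cons_val_one, one_pow, one_mul]
  exact (natDegree_C_mul_X_pow_le _ _).trans (by omega)

theorem MvPolynomial.IsHomogeneous.natDegree_aeval_X_one_le {p : MvPolynomial (Fin 2) K} {d : ℕ}
    (hp : p.IsHomogeneous d) : (MvPolynomial.aeval ![Polynomial.X, (1 : K[X])] p).natDegree ≤ d := by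
  rw [MvPolynomial.aeval_def, MvPolynomial.eval₂_eq']
  refine natDegree_sum_le_of_forall_le _ _ fun m hm => ?_
  have := hp.apply_add_apply_of_mem_support hm
  simp only [Fin.prod_univ_two, Matrix.cons_val_zero, Matrix.cons_val_one, one_pow, mul_one]
  exact (natDegree_C_mul_X_pow_le _ _).trans (by omega)

theorem MvPolynomial.IsHomogeneous.eq_zero_of_coeff_binaryExponent {p : MvPolynomial (Fin 2) K}
    {d : ℕ} (hp : p.IsHomogeneous d)
    (h : ∀ i j, i + j = d → p.coeff (binaryExponent i j) = 0) : p = 0 := by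
  ext m
  rw [MvPolynomial.coeff_zero]
  by_contra hm
  have h1 := hp.apply_add_apply_of_mem_support (MvPolynomial.mem_support_iff.2 hm)
  rw [(eq_binaryExponent_iff m _ _).2 ⟨rfl, rfl⟩] at hm
  exact hm (h _ _ h1)

theorem MvPolynomial.IsHomogeneous.aeval_one_X_eq_zero_iff {p : MvPolynomial (Fin 2) K} {d : ℕ}
    (hp : p.IsHomogeneous d) : MvPolynomial.aeval ![(1 : K[X]), Polynomial.X] p = 0 ↔ p = 0 := by
  refine ⟨fun h => hp.eq_zero_of_coeff_binaryExponent fun i j hij => ?_, fun h => by simp [h]⟩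
  rw [← hp.coeff_aeval_one_X hij, h, Polynomial.coeff_zero]

theorem MvPolynomial.IsHomogeneous.aeval_X_one_eq_zero_iff {p : MvPolynomial (Fin 2) K} {d : ℕ}
    (hp : p.IsHomogeneous d) : MvPolynomial.aeval ![Polynomial.X, (1 : K[X])] p = 0 ↔ p = 0 := by
  refine ⟨fun h => hp.eq_zero_of_coeff_binaryExponent fun i j hij => ?_, fun h => by simp [h]⟩
  rw [← hp.coeff_aeval_X_one hij, h, Polynomial.coeff_zero]

/-- The two dehomogenizations have reversed coefficient lists, so the order at ∞ is the drop in
affine degree. -/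
theorem MvPolynomial.IsHomogeneous.natDegree_add_rootMultiplicity {p : MvPolynomial (Fin 2) K}
    {d : ℕ} (hp : p.IsHomogeneous d) (h0 : p ≠ 0) :
    (MvPolynomial.aeval ![(1 : K[X]), Polynomial.X] p).natDegree +
      (MvPolynomial.aeval ![Polynomial.X, (1 : K[X])] p).rootMultiplicity 0 = d := by
  have hq0 := hp.aeval_X_one_eq_zero_iff.not.2 h0
  have hq := hp.natDegree_aeval_X_one_le
  have hr := hp.natDegree_aeval_one_X_le
  rw [rootMultiplicity_eq_natTrailingDegree']
  set q := MvPolynomial.aeval ![Polynomial.X, (1 : K[X])] p with hq'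
  have hle : q.natTrailingDegree ≤ d := (natTrailingDegree_le_natDegree q).trans hq
  have : (MvPolynomial.aeval ![(1 : K[X]), Polynomial.X] p).natDegree = d - q.natTrailingDegree := by
    refine natDegree_eq_of_le_of_coeff_ne_zero ?_ ?_
    · refine natDegree_le_iff_coeff_eq_zero.2 fun N hN => ?_
      by_cases hNd : N ≤ d
      · have hN' : d - N + N = d := Nat.sub_add_cancel hNd
        rw [hp.coeff_aeval_one_X hN', ← hp.coeff_aeval_X_one hN', ← hq']
        exact coeff_eq_zero_of_lt_natTrailingDegree (by omega)
      · exact coeff_eq_zero_of_natDegree_lt (by omega)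
    · have hN' : q.natTrailingDegree + (d - q.natTrailingDegree) = d := by omega
      rw [hp.coeff_aeval_one_X hN', ← hp.coeff_aeval_X_one hN', ← hq']
      exact mt trailingCoeff_eq_zero.1 hq0
  omega

theorem Polynomial.rootMultiplicity_eq_of_iterate_derivative [CharZero K] {f : K[X]} {a : K}
    {j : ℕ} (h0 : ∀ l < j, (derivative^[l] f).eval a = 0) (hj : (derivative^[j] f).eval a ≠ 0) :
    f ≠ 0 ∧ f.rootMultiplicity a = j := by
  have hf : f ≠ 0 := fun hf => hj (by simp [hf])
  refine ⟨hf, le_antisymm ?_ ?_⟩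
  · by_contra! h
    exact hj ((lt_rootMultiplicity_iff_isRoot_iterate_derivative hf).1 h j le_rfl)
  · cases j with
    | zero => exact Nat.zero_le _
    | succ j =>
      exact (lt_rootMultiplicity_iff_isRoot_iterate_derivative hf).2 fun l hl => h0 l (by omega)

end BinaryForms

/-! ### Schubert positions along the curve as zeros of a Wronskian. -/

namespace RationalNormalCurve

open Polynomial

variable {k n : ℕ}

/-- Restriction of forms to the affine chart in which derivatives at `a` are taken. -/
noncomputable def chart : OnePoint ℂ → (MvPolynomial (Fin 2) ℂ →ₐ[ℂ] ℂ[X])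
  | some _ => MvPolynomial.aeval ![(1 : ℂ[X]), X]
  | none => MvPolynomial.aeval ![X, (1 : ℂ[X])]

/-- The coordinate of `a` in the chart at `a`. -/
def coordinate : OnePoint ℂ → ℂ
  | some t => t
  | none => 0

theorem derivAt_apply (γ : RationalNormalCurve n) (j : ℕ) (a : OnePoint ℂ) (i : Fin n) :
    γ.derivAt j a i = (derivative^[j] (chart a (γ i).1)).eval (coordinate a) := by
  cases a <;> rfl

/-- The form obtained by composing the curve with a linear functional. -/
noncomputable def form (γ : RationalNormalCurve n) :
    Module.Dual ℂ (Fin n → ℂ) →ₗ[ℂ] MvPolynomial (Fin 2) ℂ where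
  toFun f := ∑ i, f (Pi.single i 1) • (γ i).1
  map_add' f g := by simp [add_smul, Finset.sum_add_distrib]
  map_smul' c f := by simp [mul_smul, Finset.smul_sum]

theorem form_apply (γ : RationalNormalCurve n) (f : Module.Dual ℂ (Fin n → ℂ)) :
    γ.form f = ∑ i, f (Pi.single i 1) • (γ i).1 := rfl

theorem isHomogeneous_form (γ : RationalNormalCurve n) (f : Module.Dual ℂ (Fin n → ℂ)) :
    (γ.form f).IsHomogeneous (n - 1) :=
  Submodule.sum_mem _ fun i _ => Submodule.smul_mem _ _ (γ i).2

theorem form_eq_zero_iff (γ : RationalNormalCurve n) (f : Module.Dual ℂ (Fin n → ℂ)) :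
    γ.form f = 0 ↔ f = 0 := by
  refine ⟨fun h => ?_, fun h => by simp [h]⟩
  have h1 : ∑ i, f (Pi.single i 1) • γ i = 0 := Subtype.ext (by simpa [form_apply] using h)
  have h2 := Fintype.linearIndependent_iff.1 γ.linearIndependent _ h1
  exact LinearMap.pi_ext' fun i => LinearMap.ext_ring (by simpa using h2 i)

theorem apply_derivAt (γ : RationalNormalCurve n) (f : Module.Dual ℂ (Fin n → ℂ)) (j : ℕ)
    (a : OnePoint ℂ) :
    f (γ.derivAt j a) = (derivative^[j] (chart a (γ.form f))).eval (coordinate a) := by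
  rw [LinearMap.pi_apply_eq_sum_univ f, form_apply, map_sum, iterate_derivative_sum,
    eval_finsetSum]
  refine Finset.sum_congr rfl fun i _ => ?_
  rw [map_smul, iterate_derivative_smul, eval_smul, derivAt_apply, smul_eq_mul, smul_eq_mul,
    mul_comm]
  congr 2
  ext j
  simp [Pi.single_apply, eq_comm]

theorem natDegree_chart_form_le (γ : RationalNormalCurve n) (f : Module.Dual ℂ (Fin n → ℂ))
    (a : OnePoint ℂ) : (chart a (γ.form f)).natDegree ≤ n - 1 := by
  cases a
  · exact (γ.isHomogeneous_form f).natDegree_aeval_X_one_le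
  · exact (γ.isHomogeneous_form f).natDegree_aeval_one_X_le

theorem chart_form_eq_zero_iff (γ : RationalNormalCurve n) (f : Module.Dual ℂ (Fin n → ℂ))
    (a : OnePoint ℂ) : chart a (γ.form f) = 0 ↔ f = 0 := by
  rw [← γ.form_eq_zero_iff]
  cases a
  · exact (γ.isHomogeneous_form f).aeval_X_one_eq_zero_iff
  · exact (γ.isHomogeneous_form f).aeval_one_X_eq_zero_iff

/-- A nonzero functional killing all n derivatives would give a nonzero polynomial of degree at most
n-1 with a root of multiplicity at least n. -/
theorem linearIndependent_derivAt (γ : RationalNormalCurve n) (a : OnePoint ℂ) :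
    LinearIndependent ℂ fun j : Fin n => γ.derivAt j a := by
  refine linearIndependent_of_top_le_span_of_card_eq_finrank ?_ (by simp)
  rw [top_le_iff]
  by_contra h
  obtain ⟨f, hf, hle⟩ := Submodule.exists_le_ker_of_lt_top _ (lt_top_iff_ne_top.2 h)
  have h0 := (γ.chart_form_eq_zero_iff f a).not.2 hf
  have hn : 0 < n := by
    rcases Nat.eq_zero_or_pos n with rfl | hn
    · exact (hf (Subsingleton.elim _ _)).elim
    · exact hn
  have hlt : n - 1 < (chart a (γ.form f)).rootMultiplicity (coordinate a) := by
    refine (lt_rootMultiplicity_iff_isRoot_iterate_derivative h0).2 fun l hl => ?_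
    rw [IsRoot, ← apply_derivAt]
    exact hle (Submodule.subset_span ⟨⟨l, by omega⟩, rfl⟩)
  have h1 := (Multiset.count_le_card (coordinate a) _).trans (chart a (γ.form f)).card_roots'
  rw [count_roots] at h1
  have h2 := γ.natDegree_chart_form_le f a
  omega

theorem card_jumps_derivAt (γ : RationalNormalCurve n) (H : Gr k n) (a : OnePoint ℂ) :
    (jumps n (fun j => γ.derivAt j a) H.1).card = k :=
  (card_jumps (v := fun j => γ.derivAt j a) (γ.linearIndependent_derivAt a)
    (Module.finrank_fin_fun ℂ) H.1).trans H.2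

/-- The Schubert position of `H` with respect to the osculating flag at `a`. -/
noncomputable def position (γ : RationalNormalCurve n) (H : Gr k n) (a : OnePoint ℂ) :
    SchubertCondition k n :=
  (jumps n (fun j => γ.derivAt j a) H.1).orderEmbOfFin (γ.card_jumps_derivAt H a)

theorem mem_schubertVariety_osculatingFlag_iff (γ : RationalNormalCurve n) (H : Gr k n)
    (a : OnePoint ℂ) (β : SchubertCondition k n) :
    H ∈ schubertVariety β (γ.osculatingFlag a) ↔ ∀ i, γ.position H a i ≤ β i := by
  refine forall_congr' fun i => ?_
  rw [position, orderEmbOfFin_le_iff,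
    ← finrank_inf_spanFlag (v := fun j => γ.derivAt j a) (γ.linearIndependent_derivAt a) H.1 (β i).2]
  rfl

theorem exists_adapted_family (γ : RationalNormalCurve n) (H : Gr k n) (a : OnePoint ℂ) :
    ∃ (b : Fin (n - k) → Fin n) (f : Fin (n - k) → H.1.dualAnnihilator), Function.Injective b ∧
      (γ.position H a).codim = ∑ i, ((b i : ℕ) : ℤ) - ∑ i : Fin (n - k), ((i : ℕ) : ℤ) ∧
      ∀ i, chart a (γ.form (f i)) ≠ 0 ∧
        (chart a (γ.form (f i))).rootMultiplicity (coordinate a) = b i := by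
  set J := jumps n (fun j => γ.derivAt j a) H.1 with hJ
  have hcard : Jᶜ.card = n - k := by
    rw [Finset.card_compl, Fintype.card_fin, γ.card_jumps_derivAt H a]
  have hb (i) := Finset.mem_compl.1 (Finset.orderEmbOfFin_mem Jᶜ hcard i)
  choose f hf h0 h1 using fun i => exists_dual_of_notMem_jumps (hb i)
  refine ⟨Jᶜ.orderEmbOfFin hcard, fun i => ⟨f i, hf i⟩, (Jᶜ.orderEmbOfFin hcard).injective, ?_,
    fun i => ?_⟩
  · rw [position, SchubertCondition.codim_orderEmbOfFin]
    congr 1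
    conv_lhs => rw [← hJ, ← Finset.map_orderEmbOfFin_univ Jᶜ hcard, Finset.sum_map]
    rfl
  · refine rootMultiplicity_eq_of_iterate_derivative (fun l hl => ?_) ?_
    · rw [← apply_derivAt]
      exact h0 i l hl
    · rw [← apply_derivAt]
      exact h1 i

theorem exists_codim_position_eq (hkn : k < n) (γ : RationalNormalCurve n) (H : Gr k n) :
    ∃ W : ℂ[X], W ≠ 0 ∧ (∀ t : ℂ, (γ.position H t).codim = W.rootMultiplicity t) ∧
      (γ.position H OnePoint.infty).codim = k * (n - k) - W.natDegree := by
  have hrank : Module.finrank ℂ H.1.dualAnnihilator = n - k := by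
    have := Subspace.finrank_add_finrank_dualAnnihilator_eq H.1
    rw [H.2, Module.finrank_fin_fun] at this
    omega
  let e := Module.finBasisOfFinrankEq ℂ H.1.dualAnnihilator hrank
  let φ (f : Module.Dual ℂ (Fin n → ℂ)) : ℂ[X] := MvPolynomial.aeval ![(1 : ℂ[X]), X] (γ.form f)
  -- Adapted families vary with the point; comparing each with the fixed basis `e` makes a single
  -- Wronskian serve all points.
  have hφ (f : Fin (n - k) → H.1.dualAnnihilator) :
      ∃ c : ℂ, wronskianDet (fun j => φ (f j)) = wronskianDet (fun j => φ (e j)) * C c := by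
    refine ⟨(Matrix.of fun l j => e.repr (f j) l).det, ?_⟩
    rw [← wronskianDet_sum_smul]
    congr 1
    ext1 j
    have h := congrArg (fun x : H.1.dualAnnihilator => φ x) (e.sum_repr (f j))
    refine h.symm.trans ?_
    simp only [φ, Submodule.coe_sum, Submodule.coe_smul, map_sum, map_smul, Matrix.of_apply]
  have hfin (t : ℂ) : wronskianDet (fun j => φ (e j)) ≠ 0 ∧
      (γ.position H t).codim = (wronskianDet fun j => φ (e j)).rootMultiplicity t := by
    obtain ⟨b, f, hb, hc, hf⟩ := γ.exists_adapted_family H t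
    obtain ⟨c, hc'⟩ := hφ f
    have hb' : (fun j => (φ (f j)).rootMultiplicity t) = fun j => (b j : ℕ) :=
      funext fun j => (hf j).2
    obtain ⟨h1, h2⟩ := wronskianDet_rootMultiplicity t (fun j => φ (f j)) (fun j => (hf j).1)
      (by rw [hb']; exact Fin.val_injective.comp hb)
    rw [funext_iff] at hb'
    simp only [hb'] at h2
    have hc0 : c ≠ 0 := fun h => h1 (by rw [hc', h]; simp)
    refine ⟨fun h => h1 (by rw [hc', h]; simp), ?_⟩
    rw [hc', rootMultiplicity_mul (hc' ▸ h1), rootMultiplicity_C, add_zero] at h2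
    rw [hc, ← Nat.cast_sum, ← h2]
    push_cast
    ring
  refine ⟨wronskianDet fun j => φ (e j), (hfin 0).1, fun t => (hfin t).2, ?_⟩
  obtain ⟨b, f, hb, hc, hf⟩ := γ.exists_adapted_family H OnePoint.infty
  obtain ⟨c, hc'⟩ := hφ f
  have hne (j) : γ.form (f j) ≠ 0 := fun h => (hf j).1 (by rw [h, map_zero])
  have hdeg (j) : (φ (f j)).natDegree + b j = n - 1 := by
    rw [← (γ.isHomogeneous_form (f j)).natDegree_add_rootMultiplicity (hne j), ← (hf j).2]
    rfl
  have hinj : Function.Injective fun j => (φ (f j)).natDegree := fun i j hij => by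
    have h1 := hdeg i
    have h2 := hdeg j
    simp only at hij
    exact hb (Fin.ext (by omega))
  obtain ⟨h2, h1⟩ := wronskianDet_natDegree (fun j => φ (f j))
    (fun j => (γ.isHomogeneous_form (f j)).aeval_one_X_eq_zero_iff.not.2 (hne j)) hinj
  have hc0 : c ≠ 0 := fun h => h2 (by rw [hc', h]; simp)
  rw [hc', natDegree_mul_C hc0] at h1
  -- Since 0 + 1 + ⋯ + (n-k-1) enters both the degree and the codimension, it is removed twice:
  -- (n-k)(n-1) - (n-k)(n-k-1) = k(n-k).
  have h3 := Finset.sum_congr rfl fun j (_ : j ∈ Finset.univ) => hdeg j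
  rw [Finset.sum_add_distrib, ← h1, Finset.sum_const, Finset.card_univ, Fintype.card_fin,
    smul_eq_mul] at h3
  have gauss := Finset.sum_range_id_mul_two (n - k)
  rw [← Fin.sum_univ_eq_sum_range (fun i => i)] at gauss
  rw [hc]
  zify [hkn.le, show 1 ≤ n by omega, show 1 ≤ n - k by omega] at h3 gauss
  linarith

theorem exists_finset_codim_position (hkn : k < n) (γ : RationalNormalCurve n) (H : Gr k n) :
    ∃ S : Finset (OnePoint ℂ), (∀ a, a ∈ S ↔ 0 < (γ.position H a).codim) ∧
      ∑ a ∈ S, (γ.position H a).codim = k * (n - k) := by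
  classical
  obtain ⟨W, hW, hfin, hinf⟩ := γ.exists_codim_position_eq hkn H
  have hroots : ∑ t ∈ W.roots.toFinset, (γ.position H t).codim = W.natDegree := by
    simp only [hfin, ← count_roots]
    rw [← Nat.cast_sum, Multiset.toFinset_sum_count_eq,
      (IsAlgClosed.splits W).natDegree_eq_card_roots]
  -- The point ∞ is included even if its codimension is zero; the filter below then drops it.
  let T : Finset (OnePoint ℂ) := insert OnePoint.infty (W.roots.toFinset.map ⟨_, OnePoint.coe_injective⟩)
  have hT : ∑ a ∈ T, (γ.position H a).codim = k * (n - k) := by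
    rw [Finset.sum_insert (by simp), Finset.sum_map, hinf]
    simp only [Function.Embedding.coeFn_mk, hroots]
    ring
  refine ⟨T.filter fun a => 0 < (γ.position H a).codim, fun a => ?_, ?_⟩
  · rw [Finset.mem_filter, and_iff_right_iff_imp]
    intro ha
    cases a with
    | infty => exact Finset.mem_insert_self _ _
    | coe t =>
      rw [hfin, Nat.cast_pos, rootMultiplicity_pos hW] at ha
      simp [T, hW, ha.eq_zero]
  · rw [← hT]
    refine Finset.sum_filter_of_ne fun a _ ha => ?_
    exact (SchubertCondition.codim_nonneg _).lt_of_ne ha.symm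

end RationalNormalCurve

/-! ### Existence and uniqueness of the Schubert problem. -/

theorem mainTheorem2 (k n : ℕ) (hk : 0 < k) (hkn : k < n)
    (γ : RationalNormalCurve n) (H : Gr k n) :
    ∃ (m : ℕ) (α : Fin m → SchubertCondition k n) (a : Fin m → OnePoint ℂ),
      (Function.Injective a ∧ (∀ i, 0 < (α i).codim) ∧ IsSchubertProblem α ∧
        H ∈ γ.osculatingInstance α a) ∧
      ∀ (p : ℕ) (β : Fin p → SchubertCondition k n) (b : Fin p → OnePoint ℂ),
        Function.Injective b → (∀ i, 0 < (β i).codim) → IsSchubertProblem β →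
        H ∈ γ.osculatingInstance β b →
        ∃ e : Fin p ≃ Fin m, ∀ i, β i = α (e i) ∧ b i = a (e i) := by
  classical
  obtain ⟨S, hS, hsum⟩ := γ.exists_finset_codim_position hkn H
  have hmem (m : ℕ) (β : Fin m → SchubertCondition k n) (b : Fin m → OnePoint ℂ) :
      H ∈ γ.osculatingInstance β b ↔ ∀ i j, γ.position H (b i) j ≤ β i j := by
    simp only [RationalNormalCurve.osculatingInstance, Set.mem_iInter,
      γ.mem_schubertVariety_osculatingFlag_iff]
  let s := S.equivFin
  refine ⟨S.card, fun i => γ.position H (s.symm i), fun i => s.symm i,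
    ⟨Subtype.val_injective.comp s.symm.injective, fun i => (hS _).1 (s.symm i).2, ?_,
      (hmem _ _ _).2 fun i j => le_rfl⟩, ?_⟩
  · rw [IsSchubertProblem, ← hsum, ← Finset.sum_coe_sort S]
    exact s.symm.sum_comp fun a : S => (γ.position H a).codim
  intro p β b hb hpos hβ hH
  rw [hmem] at hH
  have hle (i) : (β i).codim ≤ (γ.position H (b i)).codim :=
    SchubertCondition.codim_le_codim (hH i)
  have hbS (i) : b i ∈ S := (hS _).2 ((hpos i).trans_le (hle i))
  have himage : Finset.univ.image b ⊆ S := Finset.image_subset_iff.2 fun i _ => hbS i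
  have h1 : ∑ i, (γ.position H (b i)).codim = ∑ a ∈ Finset.univ.image b, (γ.position H a).codim :=
    (Finset.sum_image (f := fun a => (γ.position H a).codim) fun i _ j _ h => hb h).symm
  have h2 : ∑ a ∈ Finset.univ.image b, (γ.position H a).codim ≤ ∑ a ∈ S, (γ.position H a).codim :=
    Finset.sum_le_sum_of_subset_of_nonneg himage fun a ha _ => ((hS a).1 ha).le
  have h3 : ∑ i, (β i).codim = ∑ a ∈ S, (γ.position H a).codim := hβ.trans hsum.symm
  have h4 := Finset.sum_le_sum fun i (_ : i ∈ Finset.univ) => hle i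
  -- The chain Σ|β i| ≤ Σ|position at b i| ≤ Σ over `S` has equal ends, so it is tight term by term.
  have hβeq (i) : β i = γ.position H (b i) := by
    have h5 := (Finset.sum_eq_sum_iff_of_le fun i (_ : i ∈ Finset.univ) => hle i).1
      (h4.antisymm (by linarith)) i (Finset.mem_univ i)
    exact (SchubertCondition.eq_of_codim_le (hH i) h5.ge).symm
  have hsurj : Finset.univ.image b = S := by
    -- A point of `S` missed by `b` would contribute a positive codimension and make the second
    -- inequality strict.
    by_contra hne
    obtain ⟨a, ha, ha'⟩ := Finset.exists_of_ssubset (himage.ssubset_of_ne hne)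
    have := Finset.sum_lt_sum_of_subset himage ha ha' ((hS a).1 ha)
      fun x hx _ => ((hS x).1 hx).le
    linarith
  let e : Fin p ≃ S := Equiv.ofBijective (fun i => ⟨b i, hbS i⟩)
    ⟨fun i j h => hb (congrArg Subtype.val h), fun x => by
      obtain ⟨i, -, hi⟩ := Finset.mem_image.1 (hsurj ▸ x.2 : (x : OnePoint ℂ) ∈ Finset.univ.image b)
      exact ⟨i, Subtype.ext hi⟩⟩
  have he (i) : ((s.symm ((e.trans s) i) : S) : OnePoint ℂ) = b i := by
    rw [Equiv.trans_apply, Equiv.symm_apply_apply]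
    rfl
  refine ⟨e.trans s, fun i => ⟨?_, (he i).symm⟩⟩
  simp only [he, hβeq]
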